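/- All ordinal arithmetic is ordinal arithmetic, and every ordinal carries its order topology. For ordinals $\alpha,\beta$ and a positive integer $k$, consider an arbitrary coloring $c:[\beta]^2\to\{\text{red},\text{blue}\}$ of the $2$-element subsets of $\beta$. Write $\beta\to(\alpha,k)^2$ (respectively $\beta\to_{top}(\alpha,k)^2$, $\beta\to_{cl}(\alpha,k)^2$) if for every such $c$ there is either a blue-homogeneous subset of $\beta$ of size $k$, or a red-homogeneous subset $X\subseteq\beta$ that is order-isomorphic to $\alpha$ (respectively: that with the subspace topology is homeomorphic to $\alpha$; that admits a bijection onto $\alpha$ which is both an order-isomorphism and a homeomorphism). Let $R(\alpha,k)$, $R^{top}(\alpha,k)$, $R^{cl}(\alpha,k)$ be the least $\beta$ satisfying the respective relation, when one exists. Let $\alpha$ be a countable nonzero ordinal and let $k,m,n$ be positive integers. Then all of the following numbers exist, and: (1) $R^{top}(\omega^{\omega^\alpha},k+1)=R^{cl}(\omega^{\omega^\alpha},k+1)\leq\omega^{\omega^{\alpha\cdot k}}$. (2) $R^{top}(\omega^{\omega^\alpha}+1,k+1)=R^{cl}(\omega^{\omega^\alpha}+1,k+1)$, and this ordinal is at most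 $\omega^{\omega^{\alpha\cdot k}}+1$ if $\alpha$ is infinite, and at most $\omega^{\omega^{(p+1)\cdot k-1}}+1$ if $\alpha=p$ is finite. (3) $R^{top}(\omega^n\cdot m+1,k+2)=R^{cl}(\omega^n\cdot m+1,k+2)\leq\omega^{\omega^k\cdot n}\cdot R(m,k+2)+1$. In particular, for every countable ordinal $\alpha$ (zero allowed) and every positive integer $k$, the numbers $R^{top}(\alpha,k)$ and $R^{cl}(\alpha,k)$ exist and are countable. -/

import Mathlib

open scoped Ordinal Cardinal

universe u v

namespace OrdinalRamsey

/-- The set `[β]^n` of subsets of size `n` of the ordinal `β`, where `β` is identified with the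
set `Set.Iio β` of its predecessors. -/
abbrev Subsets (β : Ordinal.{u}) (n : ℕ) : Type (u + 1) :=
  {s : Finset (Set.Iio β) // s.card = n}

/-- `X` is `i`-homogeneous for the coloring `c`: every subset of `X` of size `n` has color `i`. -/
def Homogeneous {β : Ordinal.{u}} {n : ℕ} {ι : Type v} (c : Subsets β n → ι)
    (X : Set (Set.Iio β)) (i : ι) : Prop :=
  ∀ s : Subsets β n, (s.1 : Set (Set.Iio β)) ⊆ X → c s = i

/-- The classical partition relation `β → (α_i)^n_{i ∈ ι}`: the homogeneous set is
order-isomorphic to `α_i`. -/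
def Arrow (β : Ordinal.{u}) (n : ℕ) {ι : Type v} (α : ι → Ordinal.{u}) : Prop :=
  ∀ c : Subsets β n → ι, ∃ (X : Set (Set.Iio β)) (i : ι),
    Homogeneous c X i ∧ Nonempty (X ≃o Set.Iio (α i))

/-- The topological partition relation `β →_top (α_i)^n_{i ∈ ι}`: the homogeneous set, as a
subspace of `β`, is homeomorphic to `α_i`. -/
def TopArrow (β : Ordinal.{u}) (n : ℕ) {ι : Type v} (α : ι → Ordinal.{u}) : Prop :=
  ∀ c : Subsets β n → ι, ∃ (X : Set (Set.Iio β)) (i : ι),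
    Homogeneous c X i ∧ Nonempty (X ≃ₜ Set.Iio (α i))

/-- The closed partition relation `β →_cl (α_i)^n_{i ∈ ι}`: the homogeneous set, as a subspace
of `β`, is order-homeomorphic to `α_i`, i.e. some bijection is both an order-isomorphism and a
homeomorphism. -/
def ClosedArrow (β : Ordinal.{u}) (n : ℕ) {ι : Type v} (α : ι → Ordinal.{u}) : Prop :=
  ∀ c : Subsets β n → ι, ∃ (X : Set (Set.Iio β)) (i : ι),
    Homogeneous c X i ∧ ∃ e : X ≃o Set.Iio (α i), Continuous e ∧ Continuous e.symm

/-- `ρ = R(α, k)`: the Ramsey number exists and equals `ρ`. -/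
def IsRamsey (α : Ordinal.{u}) (k : ℕ) (ρ : Ordinal.{u}) : Prop :=
  IsLeast {β : Ordinal.{u} | Arrow β 2 ![α, (k : Ordinal.{u})]} ρ

/-- `ρ = R^top(α, k)`: the topological Ramsey number exists and equals `ρ`. -/
def IsTopRamsey (α : Ordinal.{u}) (k : ℕ) (ρ : Ordinal.{u}) : Prop :=
  IsLeast {β : Ordinal.{u} | TopArrow β 2 ![α, (k : Ordinal.{u})]} ρ

/-- `ρ = R^cl(α, k)`: the closed Ramsey number exists and equals `ρ`. -/
def IsClosedRamsey (α : Ordinal.{u}) (k : ℕ) (ρ : Ordinal.{u}) : Prop :=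
  IsLeast {β : Ordinal.{u} | ClosedArrow β 2 ![α, (k : Ordinal.{u})]} ρ

end OrdinalRamsey

/-!
The proof replaces copies of ordinals by Cantor–Bendixson ranks. `limRank X g` is the set of
ordinals at which the set `X` of ordinals has rank at least `g`.

*Ranks and copies.* Let `X` and `g > 0` be countable. If `X` has rank at least `g` at some ordinal,
then `X` contains an order-homeomorphic copy of `ω ^ g` (`closedCopy_omega0_opow`); if `X` contains
`m > 0` points of rank at least `g`, then it contains one of `ω ^ g * m + 1`
(`closedCopy_omega0_opow_mul_add_one`).
Since ranks are topologically invariant, a set that is merely homeomorphic to `ω ^ g` with `g` a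
limit, or to `ω ^ g * m + 1`, has such points. So these ordinals are order-reinforcing, and their
topological and closed Ramsey numbers agree.

*Pigeonhole.* The rank of `X ∪ Y` at a point is at most the natural sum of the ranks of `X` and `Y`
there (`notMem_limRank_union`). So removing a set of rank less than `ω ^ d` does not destroy ranks
of the form `ω ^ d * s` (`mem_limRank_diff`).

*Stepping up.* Let `T` be countable without blue cliques of size `k + 1`. A blue neighbourhood has
no blue clique of size `k`; so either it contains the desired red set, or its rank is small. If
every blue neighbourhood has rank less than `ω ^ d` everywhere, then finitely many of them can be
removed without harm to the ranks `ω ^ d * s`, and a red set with rank `s` wherever `T` has rank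
`ω ^ d * s` is built point by point, meeting countably many requirements (`exists_isRed_limRank`).
So passing from `k` to `k + 1` replaces a required rank of at most `ω ^ d` by `ω ^ d * s`, where `s`
is the rank sought. For copies of `ω ^ ω ^ α` the rank grows from `ω ^ (α * k)` to
`ω ^ (α * k) * ω ^ α`. For the ordinals with a last point, a blue neighbourhood may have rank exactly
`b` where the previous relation needs a point of rank `b`, so that `ω ^ d` must exceed `b`; this
costs the additional factor `ω`, which matters only for finite `α`.

Countability of all Ramsey numbers of countable ordinals follows since each countable `α` satisfies
`α ≤ ω ^ ω ^ α`.
-/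

namespace OrdinalRamsey

open Set Order Filter
open scoped Topology

/-! ### The natural sum of ordinals -/

/-- The Hessenberg natural sum: the least function that is strictly increasing in each of its two
arguments. -/
noncomputable def natSum : Ordinal.{u} → Ordinal.{u} → Ordinal.{u}
  | a, b => sInf {c | (∀ x, ∀ _ : x < a, natSum x b < c) ∧ ∀ x, ∀ _ : x < b, natSum a x < c}
termination_by a b => (a, b)

theorem natSum_spec (a b : Ordinal.{u}) :
    (∀ x < a, natSum x b < natSum a b) ∧ ∀ x < b, natSum a x < natSum a b := by
  have h : {c | (∀ x, ∀ _ : x < a, natSum x b < c) ∧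
      ∀ x, ∀ _ : x < b, natSum a x < c}.Nonempty := by
    obtain ⟨c, hc⟩ := Ordinal.bddAbove_of_small (s := (natSum · b) '' Iio a)
    obtain ⟨d, hd⟩ := Ordinal.bddAbove_of_small (s := (natSum a ·) '' Iio b)
    refine ⟨succ (max c d), fun x hx => ?_, fun x hx => ?_⟩
    · exact lt_succ_of_le ((hc (mem_image_of_mem _ hx)).trans (le_max_left _ _))
    · exact lt_succ_of_le ((hd (mem_image_of_mem _ hx)).trans (le_max_right _ _))
  have := csInf_mem h
  rw [natSum]
  exact this

theorem natSum_le {a b c : Ordinal.{u}} (h₁ : ∀ x < a, natSum x b < c)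
    (h₂ : ∀ x < b, natSum a x < c) : natSum a b ≤ c := by
  rw [natSum]
  exact csInf_le' ⟨h₁, h₂⟩

theorem natSum_mono_left (b : Ordinal.{u}) : StrictMono (natSum · b) :=
  fun _ c h => (natSum_spec c b).1 _ h

theorem natSum_mono_right (a : Ordinal.{u}) : StrictMono (natSum a) :=
  fun _ c h => (natSum_spec a c).2 _ h

theorem natSum_zero (a : Ordinal.{u}) : natSum a 0 ≤ a := by
  induction a using WellFoundedLT.induction with
  | _ a ih => exact natSum_le (fun x hx => (ih x hx).trans_lt hx) (fun x hx => absurd hx (by simp))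

theorem natSum_natCast (m n : ℕ) : natSum (m : Ordinal.{u}) n ≤ (m + n : ℕ) := by
  induction h : m + n using Nat.strong_induction_on generalizing m n with
  | _ s ih =>
    refine natSum_le (fun x hx => ?_) (fun x hx => ?_)
    · obtain ⟨i, rfl⟩ := Ordinal.lt_omega0.1 (hx.trans (Ordinal.natCast_lt_omega0 m))
      have hi : i < m := by exact_mod_cast hx
      exact (ih (i + n) (by omega) i n rfl).trans_lt (by exact_mod_cast (by omega))
    · obtain ⟨i, rfl⟩ := Ordinal.lt_omega0.1 (hx.trans (Ordinal.natCast_lt_omega0 n))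
      have hi : i < n := by exact_mod_cast hx
      exact (ih (m + i) (by omega) m i rfl).trans_lt (by exact_mod_cast (by omega))

theorem lt_mul_add_cases {w a r x : Ordinal.{u}} (hw : w ≠ 0) (h : x < w * a + r) (hr : r < w) :
    ∃ a' r', x = w * a' + r' ∧ r' < w ∧ (a' < a ∨ a' = a ∧ r' < r) := by
  refine ⟨x / w, x % w, (Ordinal.div_add_mod x w).symm, Ordinal.mod_lt x hw, ?_⟩
  have hle : x / w ≤ a := by
    by_contra! hlt
    have h1 : w * a + w ≤ x := by
      rw [← Ordinal.mul_succ]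
      exact (mul_le_mul_right (succ_le_of_lt hlt) w).trans (Ordinal.mul_div_le x w)
    exact absurd (h1.trans_lt h) (by simpa using hr.le)
  rcases hle.lt_or_eq with h' | h'
  · exact Or.inl h'
  · refine Or.inr ⟨h', ?_⟩
    rw [← Ordinal.div_add_mod x w, h'] at h
    exact lt_of_add_lt_add_left h

theorem mul_add_lt_mul_add {w a a' r s : Ordinal.{u}} (ha : a' < a) (hr : r < w) :
    w * a' + r < w * a + s :=
  calc w * a' + r < w * a' + w := by simpa using hr
    _ = w * succ a' := (Ordinal.mul_succ _ _).symm
    _ ≤ w * a := mul_le_mul_right (succ_le_of_lt ha) w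
    _ ≤ w * a + s := le_self_add

/-- Natural sums can be computed digit by digit in base `w`, when `w` is closed under natural
sums. -/
theorem natSum_mul_add {w : Ordinal.{u}} (hw : w ≠ 0)
    (hp : ∀ r < w, ∀ s < w, natSum r s < w) (a b : Ordinal.{u}) {r s : Ordinal.{u}}
    (hr : r < w) (hs : s < w) :
    natSum (w * a + r) (w * b + s) ≤ w * natSum a b + natSum r s := by
  induction hx : w * a + r using WellFoundedLT.induction generalizing a r b s with
  | _ x ihx =>
  induction hy : w * b + s using WellFoundedLT.induction generalizing b s with
  | _ y ihy =>
  subst hx hy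
  refine natSum_le (fun z hz => ?_) (fun z hz => ?_)
  · obtain ⟨a', r', rfl, hr', h⟩ := lt_mul_add_cases hw hz hr
    refine (ihx _ hz a' b hr' hs rfl).trans_lt ?_
    rcases h with h | ⟨rfl, h⟩
    · exact mul_add_lt_mul_add (natSum_mono_left b h) (hp _ hr' _ hs)
    · exact (add_lt_add_iff_left _).2 (natSum_mono_left s h)
  · obtain ⟨b', s', rfl, hs', h⟩ := lt_mul_add_cases hw hz hs
    refine (ihy _ hz b' hs' rfl).trans_lt ?_
    rcases h with h | ⟨rfl, h⟩
    · exact mul_add_lt_mul_add (natSum_mono_right a h) (hp _ hr _ hs')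
    · exact (add_lt_add_iff_left _).2 (natSum_mono_right r h)

theorem natSum_lt_omega0_opow (d : Ordinal.{u}) :
    ∀ r < ω ^ d, ∀ s < ω ^ d, natSum r s < ω ^ d := by
  induction d using Ordinal.limitRecOn with
  | zero =>
    intro r hr s hs
    have hr : r = 0 := by simpa using hr
    have hs : s = 0 := by simpa using hs
    subst hr hs
    simpa using natSum_zero 0
  | add_one d ih =>
    intro r hr s hs
    have hw : (ω : Ordinal.{u}) ^ d ≠ 0 := (Ordinal.opow_pos d Ordinal.omega0_pos).ne'
    rw [Ordinal.opow_add_one] at hr hs ⊢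
    rw [← add_zero (ω ^ d * ω)] at hr hs
    obtain ⟨a, r', rfl, hr', ha⟩ := lt_mul_add_cases hw hr hw.bot_lt
    obtain ⟨b, s', rfl, hs', hb⟩ := lt_mul_add_cases hw hs hw.bot_lt
    have ha : a < ω := ha.elim id fun h => absurd h.2 (by simp)
    have hb : b < ω := hb.elim id fun h => absurd h.2 (by simp)
    refine (natSum_mul_add hw ih a b hr' hs').trans_lt ?_
    rw [← add_zero (ω ^ d * ω)]
    refine mul_add_lt_mul_add ?_ (ih _ hr' _ hs')
    obtain ⟨m, rfl⟩ := Ordinal.lt_omega0.1 ha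
    obtain ⟨n, rfl⟩ := Ordinal.lt_omega0.1 hb
    exact (natSum_natCast m n).trans_lt (Ordinal.natCast_lt_omega0 _)
  | limit d hd ih =>
    intro r hr s hs
    obtain ⟨d₁, h₁, hr⟩ := (Ordinal.lt_opow_of_isSuccLimit Ordinal.omega0_ne_zero hd).1 hr
    obtain ⟨d₂, h₂, hs⟩ := (Ordinal.lt_opow_of_isSuccLimit Ordinal.omega0_ne_zero hd).1 hs
    have hm := max_lt h₁ h₂
    refine (ih _ hm _ (hr.trans_le ?_) _ (hs.trans_le ?_)).trans_le ?_
    · exact Ordinal.opow_le_opow_right Ordinal.omega0_pos (le_max_left _ _)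
    · exact Ordinal.opow_le_opow_right Ordinal.omega0_pos (le_max_right _ _)
    · exact Ordinal.opow_le_opow_right Ordinal.omega0_pos hm.le

/-- A natural summand below `ω ^ d` does not lead across a multiple of `ω ^ d`. -/
theorem natSum_lt_omega0_opow_mul {d c a b : Ordinal.{u}} (ha : a < ω ^ d * c) (hb : b < ω ^ d) :
    natSum a b < ω ^ d * c := by
  have hw : (ω : Ordinal.{u}) ^ d ≠ 0 := (Ordinal.opow_pos d Ordinal.omega0_pos).ne'
  rw [← add_zero (ω ^ d * c)] at ha ⊢
  obtain ⟨a, r, rfl, hr, h⟩ := lt_mul_add_cases hw ha hw.bot_lt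
  have h : a < c := h.elim id fun h => absurd h.2 (by simp)
  have := natSum_mul_add hw (natSum_lt_omega0_opow d) a 0 hr hb
  rw [mul_zero, zero_add] at this
  refine this.trans_lt (mul_add_lt_mul_add ((natSum_zero a).trans_lt h) ?_)
  exact natSum_lt_omega0_opow d _ hr _ hb

/-! ### Cantor–Bendixson rank -/

theorem accPt_principal_iff {y : Ordinal.{u}} {S : Set Ordinal.{u}} :
    AccPt y (𝓟 S) ↔ y ≠ 0 ∧ ∀ p < y, (S ∩ Ioo p y).Nonempty := by
  rw [SuccOrder.accPt_principal, isMin_iff_eq_bot, Ordinal.bot_eq_zero]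

/-- The set of points at which `X` has Cantor–Bendixson rank at least `g`: those that are, for every
`g' < g`, accumulation points of the points of `X` at which `X` has rank at least `g'`. A point of
`limRank X g` need not belong to `X`; the `g`-th derivative of `X` is `X ∩ limRank X g`. -/
noncomputable def limRank (X : Set Ordinal.{u}) (g : Ordinal.{u}) : Set Ordinal.{u} :=
  {y | ∀ g', ∀ _ : g' < g, AccPt y (𝓟 (X ∩ limRank X g'))}
termination_by g

variable {X Y T : Set Ordinal.{u}} {a b g h y p d r s t x β : Ordinal.{u}} {k m n : ℕ}

theorem mem_limRank : y ∈ limRank X g ↔ ∀ g' < g, AccPt y (𝓟 (X ∩ limRank X g')) := by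
  rw [limRank]; rfl

@[simp] theorem limRank_zero (X : Set Ordinal.{u}) : limRank X 0 = univ := by
  ext y; simp [mem_limRank]

theorem limRank_anti (X : Set Ordinal.{u}) : Antitone (limRank X) := fun _ _ hab _ hy =>
  mem_limRank.2 fun g' hg' => mem_limRank.1 hy g' (hg'.trans_le hab)

theorem mem_limRank_succ : y ∈ limRank X (g + 1) ↔ AccPt y (𝓟 (X ∩ limRank X g)) := by
  rw [mem_limRank]
  refine ⟨fun H => H g (lt_add_one_iff.2 le_rfl), fun H g' hg' => ?_⟩
  exact H.mono (principal_mono.2 (inter_subset_inter_right _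
    (limRank_anti X (lt_add_one_iff.1 hg'))))

theorem mem_limRank_iff_succ : y ∈ limRank X g ↔ ∀ g' < g, y ∈ limRank X (g' + 1) := by
  simp_rw [mem_limRank_succ, ← mem_limRank]

theorem limRank_mono (h : X ⊆ Y) (g : Ordinal.{u}) : limRank X g ⊆ limRank Y g := by
  induction g using WellFoundedLT.induction with
  | _ g ih =>
    exact fun y hy => mem_limRank.2 fun g' hg' =>
      (mem_limRank.1 hy g' hg').mono (principal_mono.2 (inter_subset_inter h (ih g' hg')))

theorem exists_Ioo_of_mem_limRank (hy : y ∈ limRank X g) (hg : h < g) (hp : p < y) :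
    ∃ z ∈ X, z ∈ limRank X h ∧ p < z ∧ z < y := by
  obtain ⟨z, hz, hz'⟩ := (accPt_principal_iff.1 (mem_limRank.1 hy h hg)).2 p hp
  exact ⟨z, hz.1, hz.2, hz'.1, hz'.2⟩

theorem mem_limRank_of_forall (hy : y ≠ 0)
    (H : ∀ h < g, ∀ p < y, ∃ z ∈ X, z ∈ limRank X h ∧ p < z ∧ z < y) : y ∈ limRank X g := by
  refine mem_limRank.2 fun h hh => (accPt_principal_iff).2 ⟨hy, fun p hp => ?_⟩
  obtain ⟨z, h1, h2, h3⟩ := H h hh p hp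
  exact ⟨z, ⟨h1, h2⟩, h3⟩

theorem pos_of_mem_limRank (hy : y ∈ limRank X g) (hg : 0 < g) : y ≠ 0 :=
  (accPt_principal_iff.1 (mem_limRank.1 hy 0 hg)).1

/-- Each `limRank X g` is a closed set. -/
theorem mem_limRank_of_accPt (hy : AccPt y (𝓟 (limRank X g))) : y ∈ limRank X g := by
  refine mem_limRank_of_forall (accPt_principal_iff.1 hy).1 fun h hh p hp => ?_
  obtain ⟨z, hz, hz'⟩ := (accPt_principal_iff.1 hy).2 p hp
  obtain ⟨x, h1, h2, h3, h4⟩ := exists_Ioo_of_mem_limRank hz hh hz'.1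
  exact ⟨x, h1, h2, h3, h4.trans hz'.2⟩

/-- If the rank of `X` at `y` is at most `g`, then near `y` the rank of `X` is at most `g`, and less
than `g` at the points of `X`. -/
theorem exists_Ioo_disjoint_limRank (hy : y ∉ limRank X (g + 1)) (h0 : y ≠ 0) :
    ∃ p < y, ∀ z, p < z → z < y → z ∉ limRank X (g + 1) ∧ (z ∈ X → z ∉ limRank X g) := by
  have h1 : ¬ AccPt y (𝓟 (X ∩ limRank X g)) := fun h => hy (mem_limRank_succ.2 h)
  have h2 : ¬ AccPt y (𝓟 (limRank X (g + 1))) := fun h => hy (mem_limRank_of_accPt h)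
  rw [accPt_principal_iff] at h1 h2
  push Not at h1 h2
  obtain ⟨p, hp, hp'⟩ := h1 h0
  obtain ⟨q, hq, hq'⟩ := h2 h0
  refine ⟨max p q, max_lt hp hq, fun z hz hzy => ⟨fun hz' => ?_, fun hX hz' => ?_⟩⟩
  · exact (eq_empty_iff_forall_notMem.1 hq') z ⟨hz', (le_max_right _ _).trans_lt hz, hzy⟩
  · exact (eq_empty_iff_forall_notMem.1 hp') z ⟨⟨hX, hz'⟩, (le_max_left _ _).trans_lt hz, hzy⟩

/-- The pigeonhole principle for ranks: the rank of `X ∪ Y` at a point is at most the natural sum of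
the ranks of `X` and of `Y` at this point. -/
theorem notMem_limRank_union (hX : y ∉ limRank X (g + 1)) (hY : y ∉ limRank Y (h + 1)) :
    y ∉ limRank (X ∪ Y) (natSum g h + 1) := by
  induction g using WellFoundedLT.induction generalizing h y with
  | _ g ihg =>
  induction h using WellFoundedLT.induction generalizing y with
  | _ h ihh =>
  intro hy
  have h0 : y ≠ 0 := pos_of_mem_limRank hy (by simp)
  obtain ⟨p, hp, hp'⟩ := exists_Ioo_disjoint_limRank hX h0
  obtain ⟨q, hq, hq'⟩ := exists_Ioo_disjoint_limRank hY h0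
  obtain ⟨z, hz, hzr, hz1, hz2⟩ :=
    exists_Ioo_of_mem_limRank hy (lt_add_one_iff.2 le_rfl) (max_lt hp hq)
  obtain ⟨a1, a2⟩ := hp' z ((le_max_left _ _).trans_lt hz1) hz2
  obtain ⟨b1, b2⟩ := hq' z ((le_max_right _ _).trans_lt hz1) hz2
  rcases hz with hz | hz
  · have := a2 hz
    rw [mem_limRank_iff_succ] at this
    push Not at this
    obtain ⟨g', hg', h'⟩ := this
    exact ihg g' hg' h' b1 (limRank_anti _ (succ_le_of_lt (natSum_mono_left h hg')) hzr)
  · have := b2 hz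
    rw [mem_limRank_iff_succ] at this
    push Not at this
    obtain ⟨h', hh', h''⟩ := this
    exact ihh h' hh' a1 h'' (limRank_anti _ (succ_le_of_lt (natSum_mono_right g hh')) hzr)

/-- Removing a set of rank less than `ω ^ d` at `y` preserves every rank at `y` that is a multiple
of `ω ^ d`. -/
theorem mem_limRank_diff (hT : y ∈ limRank T (ω ^ d * s)) (hB : y ∉ limRank X (ω ^ d)) :
    y ∈ limRank (T \ X) (ω ^ d * s) := by
  rw [mem_limRank_iff_succ] at hB ⊢
  push Not at hB
  obtain ⟨h, hh, hB⟩ := hB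
  intro g hg
  by_contra hg'
  refine notMem_limRank_union hg' hB ?_
  refine limRank_anti _ (succ_le_of_lt (natSum_lt_omega0_opow_mul hg hh)) ?_
  exact limRank_mono (by rw [sdiff_union_self]; exact subset_union_left) _ hT

/-- The rank at `y` depends only on the points below `y`. -/
theorem mem_limRank_inter_Iio (hy : y ∈ limRank X g) (hs : y ≤ s) : y ∈ limRank (X ∩ Iio s) g := by
  induction g using WellFoundedLT.induction generalizing y with
  | _ g ih =>
    rcases eq_zero_or_pos g with rfl | hg
    · simp
    refine mem_limRank_of_forall (pos_of_mem_limRank hy hg) fun h hh p hp => ?_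
    obtain ⟨z, h1, h2, h3, h4⟩ := exists_Ioo_of_mem_limRank hy hh hp
    exact ⟨z, ⟨h1, h4.trans_le hs⟩, ih h hh h2 (h4.le.trans hs), h3, h4⟩

theorem infinite_of_mem_limRank_succ (hy : y ∈ limRank X (g + 1)) : (X ∩ limRank X g).Infinite :=
  Set.Infinite.of_accPt (mem_limRank_succ.1 hy)

/-! ### Red sets of large rank

A coloring of pairs of ordinals is given by the symmetric relation `blue`; pairs that are not blue
are red. -/

/-- The points of `T` joined to `x` by a blue edge. -/
def blueNbhd (blue : Ordinal.{u} → Ordinal.{u} → Prop) (T : Set Ordinal.{u}) (x : Ordinal.{u}) :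
    Set Ordinal.{u} :=
  {z ∈ T | z ≠ x ∧ blue x z}

/-- `T` has no blue-homogeneous subset of size `k`. -/
def NoBlueClique (blue : Ordinal.{u} → Ordinal.{u} → Prop) (T : Set Ordinal.{u}) (k : ℕ) : Prop :=
  ∀ S : Finset Ordinal.{u}, (S : Set Ordinal.{u}) ⊆ T → (S : Set Ordinal.{u}).Pairwise blue →
    S.card ≠ k

/-- `X` is red-homogeneous. -/
def IsRed (blue : Ordinal.{u} → Ordinal.{u} → Prop) (X : Set Ordinal.{u}) : Prop :=
  X.Pairwise fun x y => ¬ blue x y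

variable {blue : Ordinal.{u} → Ordinal.{u} → Prop} {x : Ordinal.{u}} {k m : ℕ}

theorem NoBlueClique.mono (h : NoBlueClique blue T k) (hX : X ⊆ T) : NoBlueClique blue X k :=
  fun S hS => h S (hS.trans hX)

theorem blueNbhd_subset : blueNbhd blue T x ⊆ T := fun _ h => h.1

theorem NoBlueClique.blueNbhd (hb : Std.Symm blue) (h : NoBlueClique blue T (k + 1)) (hx : x ∈ T) :
    NoBlueClique blue (blueNbhd blue T x) k := by
  intro S hS hS' hk
  have hxS : x ∉ S := fun hxS => (hS hxS).2.1 rfl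
  refine h (insert x S) ?_ ?_ (by rw [Finset.card_insert_of_notMem hxS, hk])
  · rw [Finset.coe_insert]
    exact insert_subset hx fun z hz => (hS hz).1
  · rw [Finset.coe_insert]
    exact hS'.insert_of_symm fun z hz _ => (hS hz).2.2

theorem NoBlueClique.isRed (h : NoBlueClique blue T 2) (hb : Std.Symm blue) : IsRed blue T := by
  intro x hx y hy hxy hbl
  refine h {x, y} ?_ ?_ (Finset.card_pair hxy)
  · rw [Finset.coe_pair]; exact pair_subset hx hy
  · rw [Finset.coe_pair]; exact pairwise_pair_of_symm.2 fun _ => hbl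

theorem IsRed.insert (hb : Std.Symm blue) (hX : IsRed blue X)
    (hx : ∀ z ∈ X, x ∉ OrdinalRamsey.blueNbhd blue T z) (hxT : x ∈ T) :
    IsRed blue (insert x X) := by
  have : Std.Symm fun x y => ¬ blue x y := ⟨fun _ _ h h' => h (hb.symm _ _ h')⟩
  exact Set.Pairwise.insert_of_symm hX fun z hz hxz hbl => hx z hz ⟨hxT, hxz, hb.symm _ _ hbl⟩

/-- A form of the finite Ramsey theorem: an infinite set without blue cliques of size `k` contains
red sets of every finite size. -/
theorem exists_isRed_of_infinite (hb : Std.Symm blue) (hT : T.Infinite)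
    (h : NoBlueClique blue T k) (m : ℕ) :
    ∃ F : Finset Ordinal.{u}, (F : Set Ordinal.{u}) ⊆ T ∧ IsRed blue F ∧ F.card = m := by
  induction k generalizing T with
  | zero => exact absurd rfl (h ∅ (by simp) (by simp))
  | succ k ih =>
    by_cases H : ∃ x ∈ T, (blueNbhd blue T x).Infinite
    · obtain ⟨x, hx, hinf⟩ := H
      obtain ⟨F, hF, hF'⟩ := ih hinf (h.blueNbhd hb hx)
      exact ⟨F, hF.trans blueNbhd_subset, hF'⟩
    · clear ih
      push Not at H
      induction m with
      | zero => exact ⟨∅, by simp, by simp [IsRed], rfl⟩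
      | succ m ihm =>
        obtain ⟨F, hF, hF', hm⟩ := ihm
        -- All blue neighbourhoods are finite, so a red set can be enlarged greedily.
        have hfin : (↑F ∪ ⋃ z ∈ F, blueNbhd blue T z).Finite :=
          F.finite_toSet.union (F.finite_toSet.biUnion fun z hz => H z (hF hz))
        obtain ⟨x, hx, hx'⟩ := hT.exists_notMem_finite hfin
        simp only [mem_union, mem_iUnion, not_or, not_exists] at hx'
        refine ⟨insert x F, ?_, ?_, ?_⟩
        · rw [Finset.coe_insert]; exact insert_subset hx hF
        · rw [Finset.coe_insert]; exact hF'.insert hb (fun z hz => hx'.2 z hz) hx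
        · rw [Finset.card_insert_of_notMem hx'.1, hm]

theorem mem_limRank_diff_biUnion {B : Ordinal.{u} → Set Ordinal.{u}}
    (hy : y ∈ limRank T (ω ^ d * s)) {F : Finset Ordinal.{u}}
    (hB : ∀ x ∈ F, y ∉ limRank (B x) (ω ^ d)) :
    y ∈ limRank (T \ ⋃ x ∈ F, B x) (ω ^ d * s) := by
  classical
  induction F using Finset.induction_on with
  | empty => simpa using hy
  | insert a F ha ih =>
    rw [Finset.set_biUnion_insert, union_comm, ← sdiff_sdiff]
    exact mem_limRank_diff (ih fun x hx => hB x (Finset.mem_insert_of_mem hx))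
      (hB a (Finset.mem_insert_self a F))

/-- If all blue neighbourhoods have rank less than `ω ^ d` everywhere, then a finite red set `F` can
be enlarged by a point arbitrarily close to `g`: the rank of `T` at `g` survives the removal of the
blue neighbourhoods of the points of `F`. -/
theorem exists_insert_isRed (hb : Std.Symm blue)
    (hB : ∀ x ∈ T, ∀ y, y ∉ limRank (blueNbhd blue T x) (ω ^ d))
    {F : Finset Ordinal.{u}} (hFT : (F : Set Ordinal.{u}) ⊆ T) (hF : IsRed blue F)
    (hs : s < h) (hg : g ∈ limRank T (ω ^ d * h)) (hp : p < g) :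
    ∃ z ∈ T, z ∈ limRank T (ω ^ d * s) ∧ p < z ∧ z < g ∧ IsRed blue (insert z ↑F) := by
  have h1 := mem_limRank_diff_biUnion hg fun x hx => hB x (hFT hx) g
  have hlt : ω ^ d * s < ω ^ d * h :=
    mul_lt_mul_of_pos_left hs (Ordinal.opow_pos d Ordinal.omega0_pos)
  obtain ⟨z, hz, hzr, hz1, hz2⟩ := exists_Ioo_of_mem_limRank h1 hlt hp
  refine ⟨z, hz.1, limRank_mono sdiff_subset _ hzr, hz1, hz2,
    hF.insert hb (fun x hx hzx => ?_) hz.1⟩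
  exact hz.2 (mem_biUnion (show x ∈ (F : Set _) from hx) hzx)

/-- If all blue neighbourhoods in the countable set `T` have rank less than `ω ^ d` everywhere, then
every finite red set extends to a red set `X` whose rank is at least `s` at each of its points where
`T` has rank at least `ω ^ d * s`. The set `X` is the union of a chain of finite red sets, built by
running through countably many tasks. A task `(g, p, h, s)`, where `g` has rank at least `ω ^ d * h`
in `T` and `s < h`, asks for a point of `X` between `p` and `g` of rank at least `ω ^ d * s` in
`T`. -/
theorem exists_isRed_limRank (hb : Std.Symm blue) (hT : T.Countable)
    (hB : ∀ x ∈ T, ∀ y, y ∉ limRank (blueNbhd blue T x) (ω ^ d))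
    {t : Ordinal.{u}} (ht : (Iic t).Countable)
    {F : Finset Ordinal.{u}} (hFT : (F : Set Ordinal.{u}) ⊆ T) (hF : IsRed blue F) :
    ∃ X ⊆ T, ↑F ⊆ X ∧ IsRed blue X ∧
      ∀ s ≤ t, ∀ g ∈ X, g ∈ limRank T (ω ^ d * s) → g ∈ limRank X s := by
  classical
  have := hT.to_subtype
  have := ht.to_subtype
  obtain ⟨e, he⟩ := exists_surjective_nat (Option (T × T × Iic t × Iic t))
  let C := {F : Finset Ordinal.{u} // (F : Set Ordinal.{u}) ⊆ T ∧ IsRed blue F}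
  have step : ∀ (a : Option (T × T × Iic t × Iic t)) (F : C), ∃ F' : C, F.1 ⊆ F'.1 ∧
      ∀ (g p : T) (h s : Iic t), a = some (g, p, h, s) → g.1 ∈ F.1 → s < h →
        g.1 ∈ limRank T (ω ^ d * h.1) → p < g →
          ∃ z ∈ F'.1, z ∈ limRank T (ω ^ d * s.1) ∧ p.1 < z ∧ z < g.1 := by
    intro a F
    by_cases H : ∃ (g p : T) (h s : Iic t), a = some (g, p, h, s) ∧ g.1 ∈ F.1 ∧ s < h ∧
        g.1 ∈ limRank T (ω ^ d * h.1) ∧ p < g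
    · obtain ⟨g, p, h, s, rfl, -, hs, hg, hp⟩ := H
      obtain ⟨z, hz, hzr, hpz, hzg, hred⟩ := exists_insert_isRed hb hB F.2.1 F.2.2 hs hg hp
      refine ⟨⟨insert z F.1, ?_, by rwa [Finset.coe_insert]⟩, Finset.subset_insert _ _, ?_⟩
      · rw [Finset.coe_insert]; exact insert_subset hz F.2.1
      · rintro g' p' h' s' heq - - - -
        cases heq
        exact ⟨z, Finset.mem_insert_self _ _, hzr, hpz, hzg⟩
    · exact ⟨F, subset_rfl, fun g p h s h1 h2 h3 h4 h5 => absurd ⟨g, p, h, s, h1, h2, h3, h4, h5⟩ H⟩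
  choose f hf hf' using step
  -- Step `n` deals with task `e n.unpair.1`, so that each task is dealt with infinitely often.
  let G : ℕ → C := fun n => Nat.rec ⟨F, hFT, hF⟩ (fun n F => f (e n.unpair.1) F) n
  have hG : Monotone fun n => (G n).1 := monotone_nat_of_le_succ fun n => hf _ (G n)
  have hXT : (⋃ n, ((G n).1 : Set Ordinal.{u})) ⊆ T := iUnion_subset fun n => (G n).2.1
  refine ⟨⋃ n, (G n).1, hXT, subset_iUnion_of_subset 0 subset_rfl, ?_, ?_⟩
  · exact (pairwise_iUnion (Monotone.directed_le fun i j hij => hG hij)).2 fun n => (G n).2.2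
  · intro s
    induction s using WellFoundedLT.induction with
    | _ s ih =>
    intro hs g hg hgr
    rcases eq_zero_or_pos s with rfl | hs0
    · simp
    have hw := Ordinal.opow_pos d Ordinal.omega0_pos
    refine mem_limRank_of_forall (pos_of_mem_limRank hgr (mul_pos hw hs0)) fun h hh p hp => ?_
    -- The bound `p` is replaced by a point of `T`, so that there are only countably many tasks.
    obtain ⟨q, hq, -, hpq, hqg⟩ := exists_Ioo_of_mem_limRank hgr (mul_pos hw hs0) hp
    obtain ⟨n, hn⟩ := mem_iUnion.1 hg
    obtain ⟨i, hi⟩ := he (some (⟨g, hXT hg⟩, ⟨q, hq⟩, ⟨s, hs⟩, ⟨h, hh.le.trans hs⟩))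
    obtain ⟨z, hz, hzr, hqz, hzg⟩ := hf' (e (Nat.pair i n).unpair.1) (G (Nat.pair i n))
      ⟨g, hXT hg⟩ ⟨q, hq⟩ ⟨s, hs⟩ ⟨h, hh.le.trans hs⟩ (by rw [Nat.unpair_pair, hi])
      (hG (Nat.right_le_pair i n) hn) hh hgr hqg
    have hzX : z ∈ ⋃ n, ((G n).1 : Set Ordinal.{u}) := mem_iUnion.2 ⟨Nat.pair i n + 1, hz⟩
    exact ⟨z, hzX, ih h hh (hh.le.trans hs) z hzX hzr, hpq.trans hqz, hzg⟩

/-- In every countable set of ordinals without a blue clique of size `k`, a red set of `m` points of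
rank at least `b` yields a red set that contains `m` points of rank at least `t` in itself. -/
def PointRankArrow (b t : Ordinal.{u}) (m k : ℕ) : Prop :=
  ∀ blue : Ordinal.{u} → Ordinal.{u} → Prop, Std.Symm blue → ∀ T : Set Ordinal.{u}, T.Countable →
    NoBlueClique blue T k → ∀ F : Finset Ordinal.{u}, (F : Set Ordinal.{u}) ⊆ T ∩ limRank T b →
      IsRed blue F → F.card = m →
        ∃ X ⊆ T, IsRed blue X ∧
          ∃ F' : Finset Ordinal.{u}, (F' : Set Ordinal.{u}) ⊆ X ∩ limRank X t ∧ F'.card = m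

theorem pointRankArrow_two (t : Ordinal.{u}) (m : ℕ) : PointRankArrow t t m 2 :=
  fun _ hb T _ h F hF _ hm => ⟨T, subset_rfl, h.isRed hb, F, hF, hm⟩

/-- Stepping up from `k` to `k + 1`. A blue neighbourhood has no blue clique of size `k`; so if no
red set is as desired, then a blue neighbourhood has only finitely many points of rank at least `b`,
hence rank at most `b` everywhere. -/
theorem PointRankArrow.succ {b t : Ordinal.{u}} (H : PointRankArrow b t m k)
    (hbd : b < ω ^ d) (ht : (Iic t).Countable) : PointRankArrow (ω ^ d * t) t m (k + 1) := by
  intro blue hb T hT hk F hF hred hm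
  by_contra hcon
  have hB : ∀ x ∈ T, ∀ y, y ∉ limRank (blueNbhd blue T x) (ω ^ d) := by
    intro x hx y hy
    have hinf := infinite_of_mem_limRank_succ (limRank_anti _ (succ_le_of_lt hbd) hy)
    have hkx := hk.blueNbhd hb hx
    obtain ⟨F, hF, hred, hm⟩ := exists_isRed_of_infinite hb hinf (hkx.mono inter_subset_left) m
    obtain ⟨X, hX, hX'⟩ := H blue hb _ (hT.mono blueNbhd_subset) hkx F hF hred hm
    exact hcon ⟨X, hX.trans blueNbhd_subset, hX'⟩
  obtain ⟨X, hXT, hFX, hX, hr⟩ :=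
    exists_isRed_limRank hb hT hB ht (hF.trans inter_subset_left) hred
  exact hcon ⟨X, hXT, hX, F, fun x hx => ⟨hFX hx, hr t le_rfl x (hFX hx) (hF hx).2⟩, hm⟩

/-- Every countable set of ordinals without a blue clique of size `k` that has rank at least `b` at
some ordinal contains a red set that has rank at least `t` at some ordinal. Neither ordinal need
belong to the set. -/
def RankArrow (b t : Ordinal.{u}) (k : ℕ) : Prop :=
  ∀ blue : Ordinal.{u} → Ordinal.{u} → Prop, Std.Symm blue → ∀ T : Set Ordinal.{u}, T.Countable →
    NoBlueClique blue T k → (limRank T b).Nonempty →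
      ∃ X ⊆ T, IsRed blue X ∧ (limRank X t).Nonempty

theorem rankArrow_two (t : Ordinal.{u}) : RankArrow t t 2 :=
  fun _ hb T _ h hT => ⟨T, subset_rfl, h.isRed hb, hT⟩

/-- Stepping up from `k` to `k + 1` when the point `s` of large rank need not belong to the set `T`:
the point `s` is added to `T`, red to all other points, and is removed at the end. -/
theorem RankArrow.succ {t : Ordinal.{u}} (H : RankArrow (ω ^ d) t k) (ht : (Iic t).Countable) :
    RankArrow (ω ^ d * t) t (k + 1) := by
  rintro blue hb T hT hk ⟨s, hs⟩
  by_contra hcon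
  let T' := insert s (T ∩ Iio s)
  let blue' : Ordinal.{u} → Ordinal.{u} → Prop := fun x y => blue x y ∧ x ≠ s ∧ y ≠ s
  have hb' : Std.Symm blue' := ⟨fun x y h => ⟨hb.symm _ _ h.1, h.2.2, h.2.1⟩⟩
  have hsub : T' \ {s} ⊆ T ∩ Iio s := by
    rw [sdiff_singleton_subset_iff]
  have hB : ∀ x ∈ T', ∀ y, y ∉ limRank (blueNbhd blue' T' x) (ω ^ d) := by
    intro x hx y hy
    -- The blue neighbourhood of `x` is nonempty, so `x` is not the added point `s`.
    obtain ⟨z, hz, -⟩ := (accPt_principal_iff.1 (mem_limRank.1 hy 0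
      (Ordinal.opow_pos d Ordinal.omega0_pos))).2 0
      (pos_iff_ne_zero.2 (pos_of_mem_limRank hy (Ordinal.opow_pos d Ordinal.omega0_pos)))
    have hxT : x ∈ T := (hsub ⟨hx, hz.1.2.2.2.1⟩).1
    have hsub' : blueNbhd blue' T' x ⊆ blueNbhd blue T x := fun z hz =>
      ⟨(hsub ⟨hz.1, hz.2.2.2.2⟩).1, hz.2.1, hz.2.2.1⟩
    obtain ⟨X, hX, hX'⟩ := H blue hb _ (hT.mono blueNbhd_subset) (hk.blueNbhd hb hxT)
      ⟨y, limRank_mono hsub' _ hy⟩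
    exact hcon ⟨X, hX.trans blueNbhd_subset, hX'⟩
  obtain ⟨X, hXT, hFX, hX, hr⟩ := exists_isRed_limRank hb' (F := {s})
    ((hT.mono inter_subset_left).insert s) hB ht (by simp) (by simp [IsRed])
  have hsX := hr t le_rfl s (hFX (by simp))
    (limRank_mono (subset_insert _ _) _ (mem_limRank_inter_Iio hs le_rfl))
  have hsub2 : X ∩ Iio s ⊆ T := fun x hx => (hsub ⟨hXT hx.1, hx.2.ne⟩).1
  refine hcon ⟨X ∩ Iio s, hsub2, fun x hx y hy hxy hbl => ?_, s, mem_limRank_inter_Iio hsX le_rfl⟩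
  exact hX hx.1 hy.1 hxy ⟨hbl, hx.2.ne, hy.2.ne⟩

/-! ### Closed copies of ordinals -/

theorem omega0_opow_dvd_of_mem_limRank (hy : y ∈ limRank X g) : ω ^ g ∣ y := by
  replace hy := limRank_mono (subset_univ X) g hy
  induction g using Ordinal.limitRecOn generalizing y with
  | zero => simp
  | add_one g ih =>
    have hw : (0 : Ordinal.{u}) < ω ^ g := Ordinal.opow_pos g Ordinal.omega0_pos
    have h0 := pos_of_mem_limRank hy (by simp)
    obtain ⟨j, rfl⟩ := ih (limRank_anti _ (le_add_of_nonneg_right zero_le) hy)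
    rw [Ordinal.opow_add_one]
    refine mul_dvd_mul_left _ (Ordinal.isSuccPrelimit_iff_omega0_dvd.1 ?_)
    intro i hi
    obtain ⟨z, -, hz, hz1, hz2⟩ := exists_Ioo_of_mem_limRank hy (lt_add_one_iff.2 le_rfl)
      (mul_lt_mul_of_pos_left hi.lt hw)
    obtain ⟨l, rfl⟩ := ih hz
    exact hi.2 (lt_of_mul_lt_mul_left hz1 zero_le) (lt_of_mul_lt_mul_left hz2 zero_le)
  | limit g hg ih =>
    have hw : (0 : Ordinal.{u}) < ω ^ g := Ordinal.opow_pos g Ordinal.omega0_pos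
    obtain ⟨g', hg', hlt⟩ := (Ordinal.lt_opow_of_isSuccLimit Ordinal.omega0_ne_zero hg).1
      (Ordinal.mod_lt y hw.ne')
    have hdvd := ih g' hg' (limRank_anti _ hg'.le hy)
    rw [← Ordinal.div_add_mod y (ω ^ g),
      Ordinal.dvd_add_iff (dvd_mul_of_dvd_left (Ordinal.opow_dvd_opow ω hg'.le) _)] at hdvd
    have h0 : y % ω ^ g = 0 := by
      by_contra hne
      exact (Ordinal.le_of_dvd hne hdvd).not_gt hlt
    exact Ordinal.dvd_of_mod_eq_zero h0

theorem mem_limRank_Iio (hd : ω ^ g ∣ y) (hy : y ≠ 0) (ha : y ≤ a) : y ∈ limRank (Iio a) g := by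
  rw [← univ_inter (Iio a)]
  refine mem_limRank_inter_Iio ?_ ha
  clear ha
  induction g using WellFoundedLT.induction generalizing y with
  | _ g ih =>
    obtain ⟨j, rfl⟩ := hd
    refine mem_limRank_of_forall hy fun h hh p hp => ?_
    have hlim : IsSuccLimit (ω ^ (g - h) * j) :=
      Ordinal.isSuccLimit_mul_left (Ordinal.isSuccLimit_opow_left Ordinal.isSuccLimit_omega0
        (Ordinal.sub_ne_zero_iff_lt.2 hh)) (pos_iff_ne_zero.2 (right_ne_zero_of_mul hy))
    have heq : ω ^ g * j = ω ^ h * (ω ^ (g - h) * j) := by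
      rw [← mul_assoc, ← Ordinal.opow_add, Ordinal.add_sub_cancel_of_le hh.le]
    rw [heq] at hp ⊢
    obtain ⟨i, hi, hpi⟩ := (Ordinal.lt_mul_iff_of_isSuccLimit hlim).1 hp
    have hw : (0 : Ordinal.{u}) < ω ^ h := Ordinal.opow_pos h Ordinal.omega0_pos
    exact ⟨ω ^ h * i, mem_univ _, ih h hh (dvd_mul_right _ _) (zero_le.trans_lt hpi).ne', hpi,
      mul_lt_mul_of_pos_left hi hw⟩

/-- A point of rank at least `g` in a countable set `X` has rank at least `g` already in some closed
subset `Y` of `X` with maximum `y`. The set `Y` consists of `y` and of countably many closed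
sets, given by induction, with maxima `z n` that witness the rank of `y`; only finitely many of them
meet any given proper initial segment of `y`, which makes the union closed. -/
theorem exists_isClosed_of_mem_limRank (hX : X.Countable) (hg : (Iio g).Countable) (hyX : y ∈ X)
    (hy : y ∈ limRank X g) (hp : p < y) :
    ∃ Y ⊆ X, Y ⊆ Ioc p y ∧ IsClosed Y ∧ y ∈ Y ∧ y ∈ limRank Y g := by
  induction g using WellFoundedLT.induction generalizing y p with
  | _ g ih =>
  rcases eq_zero_or_pos g with rfl | hg0
  · exact ⟨{y}, by simpa, by simpa, isClosed_singleton, rfl, by simp⟩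
  have hy0 : 0 < y := zero_le.trans_lt hp
  have := hX.to_subtype
  have := hg.to_subtype
  have : Nonempty X := ⟨⟨y, hyX⟩⟩
  have : Nonempty (Iio g) := ⟨⟨0, hg0⟩⟩
  obtain ⟨e, he⟩ := exists_surjective_nat (Iio g × X)
  obtain ⟨b, hb⟩ := exists_surjective_nat X
  let tr : Ordinal.{u} → Ordinal.{u} := fun q => if q < y then q else 0
  have htr : ∀ q, tr q < y := fun q => by
    by_cases hq : q < y <;> simp [tr, hq, hy0]
  -- The sequence `c` is cofinal in `y`; the `n`-th closed set is chosen above `c n`.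
  let c : ℕ → Ordinal.{u} := fun n => (Finset.range (n + 1)).sup fun i => tr (b i)
  have hc : ∀ n, c n < y := fun n => (Finset.sup_lt_iff hy0).2 fun i _ => htr _
  have key : ∀ n, ∃ z ∈ limRank X (e n).1, z < y ∧ ∃ Y ⊆ X,
      Y ⊆ Ioc (max p (max (c n) (tr (e n).2))) z ∧ IsClosed Y ∧ z ∈ Y ∧ z ∈ limRank Y (e n).1 := by
    intro n
    obtain ⟨z, h1, h2, h3, h4⟩ := exists_Ioo_of_mem_limRank hy (e n).1.2
      (max_lt hp (max_lt (hc n) (htr (e n).2)))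
    exact ⟨z, h2, h4, ih _ (e n).1.2 (hg.mono (Iio_subset_Iio (e n).1.2.le)) h1 h2 h3⟩
  choose z hz hzy Y hYX hYI hYc hzY hzr using key
  have hsub : ∀ n, Y n ⊆ insert y (⋃ n, Y n) := fun n =>
    (subset_iUnion Y n).trans (subset_insert _ _)
  refine ⟨insert y (⋃ n, Y n), insert_subset hyX (iUnion_subset hYX), ?_, ?_, mem_insert _ _, ?_⟩
  · refine insert_subset ⟨hp, le_rfl⟩ (iUnion_subset fun n w hw => ?_)
    exact ⟨(le_max_left _ _).trans_lt (hYI n hw).1, (hYI n hw).2.trans (hzy n).le⟩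
  · refine isClosed_of_closure_subset fun w hw => ?_
    have hwy : w ≤ y := by
      refine closure_minimal (insert_subset (mem_Iic.2 le_rfl) (iUnion_subset fun n w hw => ?_))
        isClosed_Iic hw
      exact (hYI n hw).2.trans (hzy n).le
    rcases hwy.eq_or_lt with rfl | hwy
    · exact mem_insert _ _
    -- Above a point `b i` of `X` in `(w, y)` lie all but finitely many of the pieces.
    obtain ⟨v, hvX, -, hwv, hvy⟩ := exists_Ioo_of_mem_limRank hy hg0 hwy
    obtain ⟨i, hi⟩ := hb ⟨v, hvX⟩
    have hcl : IsClosed ((⋃ n ∈ Finset.range i, Y n) ∪ Ici v) :=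
      (isClosed_biUnion_finset fun n _ => hYc n).union isClosed_Ici
    have hw' : w ∈ (⋃ n ∈ Finset.range i, Y n) ∪ Ici v := by
      refine closure_minimal (insert_subset (a := y) (Or.inr hvy.le)
        (iUnion_subset fun n w hw => ?_)) hcl hw
      by_cases hn : n < i
      · exact Or.inl (mem_biUnion (show n ∈ (Finset.range i : Set ℕ) by simpa) hw)
      · refine Or.inr ?_
        have hvc : v ≤ c n := by
          have hvi : tr (b i) = v := by simp [tr, hi, hvy]
          rw [← hvi]
          exact Finset.le_sup (f := fun i => tr (b i)) (Finset.mem_range.2 (by omega))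
        exact (hvc.trans ((le_max_left _ _).trans (le_max_right _ _))).trans (hYI n hw).1.le
    rcases hw' with hw' | hw'
    · obtain ⟨n, -, hn⟩ := mem_iUnion₂.1 hw'
      exact hsub n hn
    · exact absurd hwv (not_lt.2 hw')
  · refine mem_limRank_of_forall hy0.ne' fun h hh q hq => ?_
    obtain ⟨v, hvX, -, hqv, hvy⟩ := exists_Ioo_of_mem_limRank hy hg0 hq
    obtain ⟨n, hn⟩ := he (⟨h, hh⟩, ⟨v, hvX⟩)
    have hzr' := hzr n
    have hv : tr (e n).2 = v := by simp [tr, hn, hvy]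
    have hvz := (hYI n (hzY n)).1
    rw [hv] at hvz
    rw [hn] at hzr'
    refine ⟨z n, hsub n (hzY n), limRank_mono (hsub n) _ hzr', hqv.trans ?_, hzy n⟩
    exact ((le_max_right _ _).trans (le_max_right _ _)).trans_lt hvz

/-- `X` contains an order-homeomorphic copy of the ordinal `a`, given as the image of `a` under a
normal function on all ordinals. -/
def ClosedCopy (a : Ordinal.{u}) (X : Set Ordinal.{u}) : Prop :=
  ∃ e : Ordinal.{u} → Ordinal.{u}, IsNormal e ∧ ∀ x < a, e x ∈ X

theorem ClosedCopy.mono {b : Ordinal.{u}} (h : ClosedCopy b X) (hab : a ≤ b) : ClosedCopy a X :=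
  let ⟨e, he, he'⟩ := h
  ⟨e, he, fun x hx => he' x (hx.trans_le hab)⟩

/-- A closed set becomes the range of a normal function once a final segment of the ordinals is
added. -/
theorem exists_isNormal_range (hY : IsClosed Y) (s : Ordinal.{u}) :
    ∃ e : Ordinal.{u} → Ordinal.{u}, IsNormal e ∧ range e = Y ∪ Ioi s := by
  have hunb : ¬ BddAbove (Y ∪ Ioi s) := fun h =>
    not_bddAbove_Ioi s (h.mono subset_union_right)
  refine ⟨Ordinal.enumOrd (Y ∪ Ioi s), Ordinal.isNormal_enumOrd ?_ hunb,
    Ordinal.range_enumOrd hunb⟩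
  intro t ht hne hbdd
  rw [← Ici_succ] at ht ⊢
  exact closure_minimal ht (hY.union isClosed_Ici) (csSup_mem_closure hne hbdd)

/-- The index of a point in an increasing enumeration has at least the rank of the point. -/
theorem mem_limRank_of_strictMono {e : Ordinal.{u} → Ordinal.{u}} (he : StrictMono e)
    (hx : e x ∈ limRank (range e) g) : x ∈ limRank univ g := by
  induction g using WellFoundedLT.induction generalizing x with
  | _ g ih =>
    rcases eq_zero_or_pos g with rfl | hg
    · simp
    refine mem_limRank_of_forall ?_ fun h hh p hp => ?_
    · rintro rfl
      obtain ⟨_, ⟨w, rfl⟩, -, -, hw⟩ := exists_Ioo_of_mem_limRank hx hg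
        (pos_iff_ne_zero.2 (pos_of_mem_limRank hx hg))
      exact absurd (he.lt_iff_lt.1 hw) (by simp)
    · obtain ⟨_, ⟨w, rfl⟩, hw, hpw, hwx⟩ := exists_Ioo_of_mem_limRank hx hh (he hp)
      exact ⟨w, mem_univ _, ih h hh hw, he.lt_iff_lt.1 hpw, he.lt_iff_lt.1 hwx⟩

/-- A point at which `X` has rank at least `g` yields a closed copy of `ω ^ g` in `X`. In the
enumeration of a closed set, a point of rank at least `g` has index divisible by `ω ^ g`. -/
theorem closedCopy_omega0_opow (hX : X.Countable) (hg : (Iio g).Countable) (hg0 : 0 < g)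
    (hy : y ∈ limRank X g) : ClosedCopy (ω ^ g) X := by
  have hy0 := pos_of_mem_limRank hy hg0
  obtain ⟨Y, hYX, hYI, hYc, hyY, hyr⟩ := exists_isClosed_of_mem_limRank (hX.insert y) hg
    (mem_insert _ _) (limRank_mono (subset_insert y X) _ hy) (pos_iff_ne_zero.2 hy0)
  obtain ⟨e, he, hr⟩ := exists_isNormal_range hYc y
  obtain ⟨x, rfl⟩ : y ∈ range e := hr ▸ Or.inl hyY
  have hx : x ∈ limRank univ g := mem_limRank_of_strictMono he.strictMono
    (limRank_mono (hr ▸ subset_union_left) _ hyr)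
  have hle := Ordinal.le_of_dvd (pos_of_mem_limRank hx hg0) (omega0_opow_dvd_of_mem_limRank hx)
  refine ⟨e, he, fun w hw => ?_⟩
  have hlt : e w < e x := he.strictMono (hw.trans_le hle)
  have hmem : e w ∈ Y ∪ Ioi (e x) := hr ▸ mem_range_self w
  exact mem_of_mem_insert_of_ne (hYX (hmem.resolve_right hlt.not_gt)) hlt.ne

theorem mul_succ_le_of_strictMono {f : Fin m → Ordinal.{u}} (hf : StrictMono f)
    (hd : ∀ i, s ∣ f i) (h0 : ∀ i, f i ≠ 0) (i : Fin m) : s * (i.1 + 1 : ℕ) ≤ f i := by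
  obtain ⟨i, hi⟩ := i
  induction i with
  | zero => simpa using Ordinal.le_of_dvd (h0 _) (hd _)
  | succ i ih =>
    obtain ⟨j, hj⟩ := hd ⟨i + 1, hi⟩
    have h1 := (ih (by omega)).trans_lt (hf (show (⟨i, by omega⟩ : Fin m) < ⟨i + 1, hi⟩ by simp))
    rw [hj] at h1 ⊢
    refine mul_le_mul_right ?_ s
    push_cast
    have := succ_le_of_lt (lt_of_mul_lt_mul_left h1 zero_le)
    simpa using this

/-- The same for `m` points of `X` of rank at least `g`: the index of the last one is at least
`ω ^ g * m`. -/
theorem closedCopy_omega0_opow_mul_add_one (hX : X.Countable) (hg : (Iio g).Countable) (hg0 : 0 < g)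
    (hm : 0 < m) {F : Finset Ordinal.{u}} (hF : (F : Set Ordinal.{u}) ⊆ X ∩ limRank X g)
    (hFm : F.card = m) : ClosedCopy (ω ^ g * m + 1) X := by
  have H : ∀ y ∈ F, ∃ Y ⊆ X, Y ⊆ Ioc 0 y ∧ IsClosed Y ∧ y ∈ Y ∧ y ∈ limRank Y g := fun y hy =>
    exists_isClosed_of_mem_limRank hX hg (hF hy).1 (hF hy).2
      (pos_iff_ne_zero.2 (pos_of_mem_limRank (hF hy).2 hg0))
  choose! Y hYX hYI hYc hyY hyr using H
  let f := F.orderEmbOfFin hFm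
  let l : Fin m := ⟨m - 1, by omega⟩
  obtain ⟨e, he, hr⟩ := exists_isNormal_range (isClosed_biUnion_finset hYc) (f l)
  have hfF : ∀ i, f i ∈ F := fun i => F.orderEmbOfFin_mem hFm i
  have hsub : ∀ i, Y (f i) ⊆ range e := fun i => by
    rw [hr]
    exact (subset_biUnion_of_mem (u := Y) (show f i ∈ (F : Set _) from hfF i)).trans
      subset_union_left
  choose x hx using fun i => hsub i (hyY _ (hfF i))
  have hxr : ∀ i, x i ∈ limRank univ g := fun i => mem_limRank_of_strictMono he.strictMono
    (by rw [hx i]; exact limRank_mono (hsub i) _ (hyr _ (hfF i)))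
  have hxm : StrictMono x := fun i j hij => he.strictMono.lt_iff_lt.1 (by
    rw [hx, hx]; exact f.strictMono hij)
  have hle := mul_succ_le_of_strictMono hxm (fun i => omega0_opow_dvd_of_mem_limRank (hxr i))
    (fun i => pos_of_mem_limRank (hxr i) hg0) l
  rw [show l.1 + 1 = m from Nat.sub_add_cancel hm] at hle
  refine ⟨e, he, fun w hw => ?_⟩
  have hlt : e w ≤ f l := by
    rw [← hx l]
    exact he.strictMono.monotone ((lt_add_one_iff.1 hw).trans hle)
  have hmem : e w ∈ (⋃ y ∈ F, Y y) ∪ Ioi (f l) := hr ▸ mem_range_self w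
  obtain ⟨y, hy, hwy⟩ := mem_iUnion₂.1 (hmem.resolve_right hlt.not_gt)
  exact hYX y hy hwy

/-- Continuous injections do not decrease ranks. -/
theorem mem_limRank_range {f : Iio a → Ordinal.{u}} (hf : Continuous f)
    (hinj : Function.Injective f) {i : Iio a} (hi : i.1 ∈ limRank (Iio a) g) :
    f i ∈ limRank (range f) g := by
  induction g using WellFoundedLT.induction generalizing i with
  | _ g ih =>
    refine mem_limRank.2 fun h hh => accPt_iff_nhds.2 fun U hU => ?_
    obtain ⟨V, hV, hVU⟩ := (mem_nhds_subtype _ _ _).1 (hf.continuousAt.preimage_mem_nhds hU)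
    obtain ⟨z, ⟨hzV, hza, hzr⟩, hzi⟩ := accPt_iff_nhds.1 (mem_limRank.1 hi h hh) V hV
    refine ⟨f ⟨z, hza⟩, ⟨hVU (a := ⟨z, hza⟩) hzV, mem_range_self _, ih h hh hzr⟩, fun heq => hzi ?_⟩
    rw [← hinj heq]

/-- If the ranks of the points of `X` are unbounded in the limit ordinal `g`, then `X` has rank at
least `g` somewhere: at a point of `X`, or at the least ordinal below which the ranks are
unbounded. -/
theorem limRank_nonempty_of_isSuccLimit (hg : IsSuccLimit g) (hX : BddAbove X)
    (H : ∀ h < g, (X ∩ limRank X h).Nonempty) : (limRank X g).Nonempty := by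
  by_cases hp : ∃ p ∈ X, ∀ h < g, p ∈ limRank X h
  · obtain ⟨p, -, hp⟩ := hp
    exact ⟨p, mem_limRank_iff_succ.2 fun h hh => hp _ (hg.succ_lt hh)⟩
  push Not at hp
  let S := {s | ∀ h < g, ∃ y ∈ X ∩ limRank X h, y < s}
  have hS : S.Nonempty := by
    obtain ⟨c, hc⟩ := hX
    refine ⟨succ c, fun h hh => ?_⟩
    obtain ⟨y, hy⟩ := H h hh
    exact ⟨y, hy, lt_succ_of_le (hc hy.1)⟩
  have hs : sInf S ∈ S := csInf_mem hS
  have hg0 : 0 < g := pos_iff_ne_zero.2 hg.ne_bot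
  refine ⟨sInf S, mem_limRank_of_forall ?_ fun h hh p hpS => ?_⟩
  · obtain ⟨y, -, hy⟩ := hs 0 hg0
    exact (zero_le.trans_lt hy).ne'
  · have h1 : p ∉ S := notMem_of_lt_csInf' hpS
    simp only [S, mem_ofPred_eq, not_forall, not_exists, not_and, not_lt] at h1
    obtain ⟨h1, hh1, H1⟩ := h1
    obtain ⟨h2, hh2, H2⟩ : ∃ h2 < g, p ∉ X ∩ limRank X h2 := by
      by_cases hpX : p ∈ X
      · obtain ⟨h2, hh2, h2'⟩ := hp p hpX
        exact ⟨h2, hh2, fun h => h2' h.2⟩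
      · exact ⟨0, hg0, fun h => hpX h.1⟩
    obtain ⟨y, ⟨hyX, hyr⟩, hys⟩ := hs (max h (max h1 h2)) (max_lt hh (max_lt hh1 hh2))
    have hy1 := limRank_anti X ((le_max_left _ _).trans (le_max_right h (max h1 h2))) hyr
    have hy2 := limRank_anti X ((le_max_right _ _).trans (le_max_right h (max h1 h2))) hyr
    refine ⟨y, hyX, limRank_anti X (le_max_left _ _) hyr, (H1 y ⟨hyX, hy1⟩).lt_of_ne ?_, hys⟩
    rintro rfl
    exact H2 ⟨hyX, hy2⟩

theorem closedCopy_range_omega0_opow (hg : IsSuccLimit g) (hgc : (Iio (ω ^ g)).Countable)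
    {f : Iio (ω ^ g) → Ordinal.{u}} (hf : Continuous f) (hinj : Function.Injective f) :
    ClosedCopy (ω ^ g) (range f) := by
  have := hgc.to_subtype
  have hg0 : 0 < g := pos_iff_ne_zero.2 hg.ne_bot
  obtain ⟨y, hy⟩ := limRank_nonempty_of_isSuccLimit hg (X := range f) Ordinal.bddAbove_of_small
    fun h hh => by
      have hlt : ω ^ h < ω ^ g := (Ordinal.opow_lt_opow_iff_right Ordinal.one_lt_omega0).2 hh
      exact ⟨f ⟨ω ^ h, hlt⟩, mem_range_self _, mem_limRank_range hf hinj (mem_limRank_Iio dvd_rfl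
        (Ordinal.opow_pos h Ordinal.omega0_pos).ne' hlt.le)⟩
  exact closedCopy_omega0_opow (countable_range f)
    (hgc.mono (Iio_subset_Iio (Ordinal.right_le_opow g Ordinal.one_lt_omega0))) hg0 hy

theorem closedCopy_range_omega0_opow_mul_add_one (hg0 : 0 < g) (hm : 0 < m)
    (hgc : (Iio (ω ^ g * m + 1)).Countable)
    {f : Iio (ω ^ g * m + 1) → Ordinal.{u}} (hf : Continuous f) (hinj : Function.Injective f) :
    ClosedCopy (ω ^ g * m + 1) (range f) := by
  have := hgc.to_subtype
  have hw : (0 : Ordinal.{u}) < ω ^ g := Ordinal.opow_pos g Ordinal.omega0_pos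
  have hlt : ∀ i : Fin m, ω ^ g * (i.1 + 1 : ℕ) < ω ^ g * m + 1 := fun i =>
    lt_add_one_iff.2 (mul_le_mul_right (by exact_mod_cast i.2) _)
  let q : Fin m → Iio (ω ^ g * m + 1) := fun i => ⟨_, hlt i⟩
  have hq : Function.Injective q := fun i j hij => by
    have := (mul_left_cancel_iff_of_pos hw).1 (congrArg Subtype.val hij)
    have : i.1 + 1 = j.1 + 1 := by exact_mod_cast this
    exact Fin.ext (by omega)
  refine closedCopy_omega0_opow_mul_add_one (F := Finset.univ.map ⟨f ∘ q, hinj.comp hq⟩)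
    (countable_range f) (hgc.mono (Iio_subset_Iio ?_)) hg0 hm ?_ (by simp)
  · refine (Ordinal.right_le_opow g Ordinal.one_lt_omega0).trans (le_add_right ?_)
    exact le_mul_of_one_le_right' (by exact_mod_cast hm)
  · intro z hz
    simp only [Finset.coe_map, Finset.coe_univ, image_univ, mem_range] at hz
    obtain ⟨i, rfl⟩ := hz
    refine ⟨mem_range_self _, mem_limRank_range hf hinj
      (mem_limRank_Iio (dvd_mul_right _ _) ?_ (hlt i).le)⟩
    exact (mul_pos hw (by exact_mod_cast Nat.succ_pos _)).ne'

/-! ### Countable and finite ordinals -/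

theorem countable_Iio_iff : (Iio a).Countable ↔ a.card ≤ ℵ₀ := by
  rw [← Cardinal.le_aleph0_iff_set_countable, Cardinal.mk_Iio_ordinal, Cardinal.lift_le_aleph0]

theorem countable_Iic (h : a.card ≤ ℵ₀) : (Iic a).Countable := by
  rw [← Iio_insert]
  exact (countable_Iio_iff.2 h).insert a

theorem card_omega0_opow_le (h : a.card ≤ ℵ₀) : (ω ^ a).card ≤ ℵ₀ := by
  refine (Ordinal.card_opow_le _ _).trans ?_
  simpa using h

theorem card_mul_le (ha : a.card ≤ ℵ₀) (hb : b.card ≤ ℵ₀) : (a * b).card ≤ ℵ₀ := by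
  rw [Ordinal.card_mul]
  exact (mul_le_mul' ha hb).trans (by simp)

theorem card_add_one_le (ha : a.card ≤ ℵ₀) : (a + 1).card ≤ ℵ₀ := by
  rw [Ordinal.card_add_one]
  exact (add_le_add_left ha 1).trans (by simp)

theorem card_natCast_le (n : ℕ) : (n : Ordinal.{u}).card ≤ ℵ₀ := by
  rw [Ordinal.card_nat]; exact Cardinal.natCast_le_aleph0

theorem natCard_Iio_natCast (k : ℕ) : Nat.card (Iio (k : Ordinal.{u})) = k := by
  rw [Nat.card, Cardinal.mk_Iio_ordinal]; simp

instance finite_Iio_natCast (k : ℕ) : Finite (Iio (k : Ordinal.{u})) := by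
  rw [← Cardinal.lt_aleph0_iff_finite, Cardinal.mk_Iio_ordinal]; simp

theorem exists_orderIso_natCast {X : Set (Iio β)} [Finite X] (hX : Nat.card X = k) :
    ∃ e : X ≃o Iio (k : Ordinal.{u}), Continuous e ∧ Continuous e.symm := by
  have := Fintype.ofFinite X
  have := Fintype.ofFinite (Iio (k : Ordinal.{u}))
  rw [Nat.card_eq_fintype_card] at hX
  have hk := natCard_Iio_natCast.{u} k
  rw [Nat.card_eq_fintype_card] at hk
  exact ⟨(Fintype.orderIsoFinOfCardEq _ hX).symm.trans (Fintype.orderIsoFinOfCardEq _ hk),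
    continuous_of_discreteTopology, continuous_of_discreteTopology⟩

theorem ClosedCopy.exists_orderIso {X : Set (Iio β)} (h : ClosedCopy a (Subtype.val '' X)) :
    ∃ X' ⊆ X, ∃ e : X' ≃o Iio a, Continuous e ∧ Continuous e.symm := by
  obtain ⟨e, he, heX⟩ := h
  have hmem : ∀ w : Iio a, ∃ h : e w < β, (⟨e w, h⟩ : Iio β) ∈ X := fun w => by
    obtain ⟨⟨z, hz⟩, hzX, hze⟩ := heX w w.2
    subst hze
    exact ⟨hz, hzX⟩
  let φ : Iio a → Iio β := fun w => ⟨e w, (hmem w).1⟩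
  have hφ : StrictMono φ := fun v w hvw => he.strictMono hvw
  have hφc : Continuous φ := (he.continuous.comp continuous_subtype_val).subtype_mk _
  have key : ∀ z : range φ, φ ((hφ.orderIso φ).symm z) = z := fun z =>
    congrArg Subtype.val ((hφ.orderIso φ).apply_symm_apply z)
  refine ⟨range φ, ?_, (hφ.orderIso φ).symm, ?_, hφc.subtype_mk _⟩
  · rintro _ ⟨w, rfl⟩
    exact (hmem w).2
  · refine OrderTopology.continuous_iff.2 fun w => ⟨?_, ?_⟩
    · convert (isOpen_Ioi (a := φ w)).preimage continuous_subtype_val using 1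
      ext z
      simp only [mem_preimage, mem_Ioi]
      rw [← hφ.lt_iff_lt, key]
    · convert (isOpen_Iio (a := φ w)).preimage continuous_subtype_val using 1
      ext z
      simp only [mem_preimage, mem_Iio]
      rw [← hφ.lt_iff_lt, key]

/-! ### Partition relations -/

/-- The blue pairs of a coloring of the pairs from `β` with colors `0` (red) and `1` (blue), as a
relation on all ordinals. -/
def blueOf (c : Subsets β 2 → Fin 2) (x y : Ordinal.{u}) : Prop :=
  ∃ (hx : x < β) (hy : y < β) (hxy : (⟨x, hx⟩ : Iio β) ≠ ⟨y, hy⟩),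
    c ⟨{⟨x, hx⟩, ⟨y, hy⟩}, Finset.card_pair hxy⟩ = 1

theorem symm_blueOf (c : Subsets β 2 → Fin 2) : Std.Symm (blueOf c) := by
  refine ⟨fun x y => ?_⟩
  rintro ⟨hx, hy, hxy, h⟩
  refine ⟨hy, hx, hxy.symm, ?_⟩
  rw [← h]
  congr 2
  exact Finset.pair_comm _ _

theorem Homogeneous.mono {ι : Type v} {c : Subsets β n → ι} {X X' : Set (Iio β)} {i : ι}
    (h : Homogeneous c X i) (hX : X' ⊆ X) : Homogeneous c X' i := fun s hs => h s (hs.trans hX)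

theorem homogeneous_zero {c : Subsets β 2 → Fin 2} {X : Set (Iio β)}
    (h : IsRed (blueOf c) (Subtype.val '' X)) : Homogeneous c X 0 := by
  rintro ⟨s, hs⟩ hsX
  obtain ⟨x, y, hxy, rfl⟩ := Finset.card_eq_two.1 hs
  simp only [Finset.coe_pair, pair_subset_iff] at hsX
  have h1 := h (mem_image_of_mem _ hsX.1) (mem_image_of_mem _ hsX.2)
    (fun h => hxy (Subtype.ext h))
  have h2 : c ⟨{x, y}, hs⟩ ≠ 1 := fun h => h1 ⟨x.2, y.2, hxy, h⟩
  omega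

theorem homogeneous_one {c : Subsets β 2 → Fin 2} {X : Set (Iio β)}
    (h : (Subtype.val '' X).Pairwise (blueOf c)) : Homogeneous c X 1 := by
  rintro ⟨s, hs⟩ hsX
  obtain ⟨x, y, hxy, rfl⟩ := Finset.card_eq_two.1 hs
  simp only [Finset.coe_pair, pair_subset_iff] at hsX
  obtain ⟨_, _, _, h1⟩ := h (mem_image_of_mem _ hsX.1) (mem_image_of_mem _ hsX.2)
    (fun h => hxy (Subtype.ext h))
  exact h1

theorem exists_subtype_of_finset {S : Finset Ordinal.{u}} (hS : (S : Set Ordinal.{u}) ⊆ Iio β) :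
    ∃ X : Set (Iio β), Subtype.val '' X = S ∧ Finite X ∧ Nat.card X = S.card := by
  have himg : Subtype.val '' (Subtype.val ⁻¹' (S : Set Ordinal.{u}) : Set (Iio β)) = S := by
    rw [Subtype.image_preimage_coe, inter_eq_right.2 hS]
  refine ⟨Subtype.val ⁻¹' S, himg, ?_, ?_⟩
  · exact (S.finite_toSet.preimage Subtype.val_injective.injOn).to_subtype
  · rw [← Nat.card_image_of_injective Subtype.val_injective, himg]; simp

/-- A variant of the closed partition relation `β → (a, k)²`, for colorings given by a symmetric
relation on the ordinals, that is visibly monotone in `a` and `k`. -/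
def StrongArrow (β a : Ordinal.{u}) (k : ℕ) : Prop :=
  ∀ blue : Ordinal.{u} → Ordinal.{u} → Prop, Std.Symm blue → NoBlueClique blue (Iio β) k →
    ∃ X ⊆ Iio β, IsRed blue X ∧ ClosedCopy a X

theorem StrongArrow.mono {k' : ℕ} (h : StrongArrow β b k) (hab : a ≤ b) (hk : k' ≤ k) :
    StrongArrow β a k' := by
  intro blue hb hno
  obtain ⟨X, hX, hred, hcopy⟩ := h blue hb fun S hS hS' hcard => by
    obtain ⟨S', hSS, hS'k⟩ := Finset.exists_subset_card_eq (hk.trans_eq hcard.symm)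
    exact hno S' ((Finset.coe_subset.2 hSS).trans hS) (hS'.mono (Finset.coe_subset.2 hSS)) hS'k
  exact ⟨X, hX, hred, hcopy.mono hab⟩

theorem exists_homogeneous_one {c : Subsets β 2 → Fin 2}
    (h : ¬ NoBlueClique (blueOf c) (Iio β) k) :
    ∃ X : Set (Iio β), Homogeneous c X 1 ∧
      ∃ e : X ≃o Iio (k : Ordinal.{u}), Continuous e ∧ Continuous e.symm := by
  simp only [NoBlueClique, not_forall, not_not] at h
  obtain ⟨S, hS, hS', hk⟩ := h
  obtain ⟨X, hX, hfin, hcard⟩ := exists_subtype_of_finset hS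
  exact ⟨X, homogeneous_one (by rwa [hX]), exists_orderIso_natCast (hcard.trans hk)⟩

theorem StrongArrow.closedArrow (h : StrongArrow β a k) :
    ClosedArrow β 2 ![a, (k : Ordinal.{u})] := by
  intro c
  by_cases hno : NoBlueClique (blueOf c) (Iio β) k
  · obtain ⟨X, hX, hred, hcopy⟩ := h _ (symm_blueOf c) hno
    have himg : Subtype.val '' (Subtype.val ⁻¹' X : Set (Iio β)) = X := by
      rw [Subtype.image_preimage_coe, inter_eq_right.2 hX]
    rw [← himg] at hcopy hred
    obtain ⟨X', hX', he⟩ := hcopy.exists_orderIso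
    exact ⟨X', 0, (homogeneous_zero hred).mono hX', he⟩
  · obtain ⟨X, hX, he⟩ := exists_homogeneous_one hno
    exact ⟨X, 1, hX, he⟩

theorem closedArrow_topArrow {ι : Type v} {α : ι → Ordinal.{u}} (h : ClosedArrow β n α) :
    TopArrow β n α := fun c =>
  let ⟨X, i, hX, e, he, he'⟩ := h c
  ⟨X, i, hX, ⟨⟨e.toEquiv, he, he'⟩⟩⟩

/-- Every homeomorphic copy of `a` among the ordinals contains an order-homeomorphic copy of `a`. -/
def OrderReinforcing (a : Ordinal.{u}) : Prop :=
  ∀ f : Iio a → Ordinal.{u}, Continuous f → Function.Injective f → ClosedCopy a (range f)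

/-- For order-reinforcing ordinals the topological and the closed partition relation agree. -/
theorem OrderReinforcing.topArrow_iff (ha : OrderReinforcing a) :
    TopArrow β 2 ![a, (k : Ordinal.{u})] ↔ ClosedArrow β 2 ![a, (k : Ordinal.{u})] := by
  refine ⟨fun h c => ?_, closedArrow_topArrow⟩
  obtain ⟨X, i, hX, ⟨e⟩⟩ := h c
  fin_cases i
  · change X ≃ₜ Iio a at e
    have hcopy := ha (fun w => (e.symm w).1.1)
      (continuous_subtype_val.comp (continuous_subtype_val.comp e.symm.continuous))
      (Subtype.val_injective.comp (Subtype.val_injective.comp e.symm.injective))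
    have himg : range (fun w => (e.symm w).1.1) = Subtype.val '' X := by
      rw [image_eq_range]
      exact e.symm.surjective.range_comp (fun z : X => z.1.1)
    rw [himg] at hcopy
    obtain ⟨X', hX', he⟩ := hcopy.exists_orderIso
    exact ⟨X', 0, hX.mono hX', he⟩
  · let e' : X ≃ Iio (k : Ordinal.{u}) := e.toEquiv
    have : Finite X := Finite.of_equiv _ e'.symm
    exact ⟨X, 1, hX, exists_orderIso_natCast ((Nat.card_congr e').trans (natCard_Iio_natCast k))⟩

theorem exists_isLeast_le {S : Set Ordinal.{u}} (h : β ∈ S) : ∃ ρ, IsLeast S ρ ∧ ρ ≤ β :=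
  ⟨sInf S, ⟨csInf_mem ⟨β, h⟩, fun _ hb => csInf_le' hb⟩, csInf_le' h⟩

theorem StrongArrow.exists_ramsey (h : StrongArrow β a k) (ha : OrderReinforcing a) :
    ∃ ρ, IsTopRamsey a k ρ ∧ IsClosedRamsey a k ρ ∧ ρ ≤ β := by
  obtain ⟨ρ, hρ, hle⟩ : ∃ ρ, IsClosedRamsey a k ρ ∧ ρ ≤ β := exists_isLeast_le h.closedArrow
  refine ⟨ρ, ?_, hρ, hle⟩
  simp only [IsTopRamsey, ha.topArrow_iff]
  exact hρ

theorem orderReinforcing_omega0_opow (ht : IsSuccLimit t) (htc : t.card ≤ ℵ₀) :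
    OrderReinforcing (ω ^ t) := fun _ hf hinj =>
  closedCopy_range_omega0_opow ht (countable_Iio_iff.2 (card_omega0_opow_le htc)) hf hinj

theorem orderReinforcing_omega0_opow_mul_add_one (ht : 0 < t) (htc : t.card ≤ ℵ₀) (hm : 0 < m) :
    OrderReinforcing (ω ^ t * m + 1) := fun _ hf hinj =>
  closedCopy_range_omega0_opow_mul_add_one ht hm (countable_Iio_iff.2
    (card_add_one_le (card_mul_le (card_omega0_opow_le htc) (card_natCast_le m)))) hf hinj

theorem RankArrow.strongArrow (h : RankArrow b t k) (hb : b.card ≤ ℵ₀) (ht : t.card ≤ ℵ₀)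
    (ht0 : 0 < t) : StrongArrow (ω ^ b) (ω ^ t) k := by
  intro blue hbl hno
  have hc := countable_Iio_iff.2 (card_omega0_opow_le hb)
  obtain ⟨X, hX, hred, y, hy⟩ := h blue hbl _ hc hno
    ⟨ω ^ b, mem_limRank_Iio dvd_rfl (Ordinal.opow_pos b Ordinal.omega0_pos).ne' le_rfl⟩
  exact ⟨X, hX, hred, closedCopy_omega0_opow (hc.mono hX) (countable_Iio_iff.2 ht) ht0 hy⟩

/-- The `r` ordinals `ω ^ b * (i + 1)`, for `i < r`, have rank at least `b`, and the classical
partition relation for `r` selects `m` of them that form a red set. -/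
theorem PointRankArrow.strongArrow (h : PointRankArrow b t m k) (hb : b.card ≤ ℵ₀)
    (ht : t.card ≤ ℵ₀) (ht0 : 0 < t) (hm : 0 < m) (hr : r.card ≤ ℵ₀)
    (hrm : ∀ blue : Ordinal.{u} → Ordinal.{u} → Prop, Std.Symm blue →
      NoBlueClique blue (Iio r) k →
        ∃ S : Finset Ordinal.{u}, (S : Set Ordinal.{u}) ⊆ Iio r ∧ IsRed blue S ∧ S.card = m) :
    StrongArrow (ω ^ b * r + 1) (ω ^ t * m + 1) k := by
  intro blue hbl hno
  have hw : (0 : Ordinal.{u}) < ω ^ b := Ordinal.opow_pos b Ordinal.omega0_pos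
  let q : Ordinal.{u} → Ordinal.{u} := fun i => ω ^ b * (i + 1)
  have hq : StrictMono q := fun i j hij =>
    mul_lt_mul_of_pos_left (by simpa using hij) hw
  have hlt : ∀ i < r, q i < ω ^ b * r + 1 := fun i hi =>
    lt_add_one_iff.2 (mul_le_mul_right (succ_le_of_lt hi) _)
  let qe : Ordinal.{u} ↪ Ordinal.{u} := ⟨q, hq.injective⟩
  obtain ⟨S, hSr, hS, hSm⟩ := hrm (fun i j => blue (q i) (q j))
    ⟨fun i j hij => hbl.symm _ _ hij⟩ fun S hSr hS hSk => by
      refine hno (S.map qe) ?_ ?_ (by simpa using hSk)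
      · rw [Finset.coe_map]
        rintro _ ⟨i, hi, rfl⟩
        exact hlt i (hSr hi)
      · rw [Finset.coe_map]
        rintro _ ⟨i, hi, rfl⟩ _ ⟨j, hj, rfl⟩ hij
        exact hS hi hj fun h => hij (congrArg q h)
  have hc : (Iio (ω ^ b * r + 1)).Countable :=
    countable_Iio_iff.2 (card_add_one_le (card_mul_le (card_omega0_opow_le hb) hr))
  obtain ⟨X, hX, hred, F, hF, hFm⟩ := h blue hbl _ hc hno (S.map qe) (by
      rw [Finset.coe_map]
      rintro _ ⟨i, hi, rfl⟩
      exact ⟨hlt i (hSr hi), mem_limRank_Iio (dvd_mul_right _ _)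
        (mul_pos hw (by simp)).ne' (hlt i (hSr hi)).le⟩) (by
      rw [Finset.coe_map]
      rintro _ ⟨i, hi, rfl⟩ _ ⟨j, hj, rfl⟩ hij
      exact hS hi hj fun h => hij (congrArg q h)) (by simpa using hSm)
  exact ⟨X, hX, hred, closedCopy_omega0_opow_mul_add_one (hc.mono hX) (countable_Iio_iff.2 ht) ht0
    hm hF hFm⟩

theorem arrow_omega0 (m k : ℕ) : Arrow ω 2 ![(m : Ordinal.{u}), (k : Ordinal.{u})] := by
  intro c
  by_cases hno : NoBlueClique (blueOf c) (Iio ω) k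
  · have hinf : (Iio (ω : Ordinal.{u})).Infinite := by
      rw [← infinite_coe_iff, Cardinal.infinite_iff, Cardinal.mk_Iio_ordinal]
      simp
    obtain ⟨F, hF, hred, hm⟩ := exists_isRed_of_infinite (symm_blueOf c) hinf hno m
    obtain ⟨X, hX, hfin, hcard⟩ := exists_subtype_of_finset hF
    obtain ⟨e, -⟩ := exists_orderIso_natCast (hcard.trans hm)
    exact ⟨X, 0, homogeneous_zero (by rwa [hX]), ⟨e⟩⟩
  · obtain ⟨X, hX, e, -⟩ := exists_homogeneous_one hno
    exact ⟨X, 1, hX, ⟨e⟩⟩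

theorem Arrow.exists_isRed (h : Arrow r 2 ![(m : Ordinal.{u}), (k : Ordinal.{u})])
    {blue : Ordinal.{u} → Ordinal.{u} → Prop} (hb : Std.Symm blue)
    (hno : NoBlueClique blue (Iio r) k) :
    ∃ S : Finset Ordinal.{u}, (S : Set Ordinal.{u}) ⊆ Iio r ∧ IsRed blue S ∧ S.card = m := by
  classical
  have key : ∀ {n : ℕ} {X : Set (Iio r)}, Nonempty (X ≃o Iio (n : Ordinal.{u})) →
      ∃ S : Finset Ordinal.{u}, (S : Set Ordinal.{u}) = Subtype.val '' X ∧ S.card = n := by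
    rintro n X ⟨e⟩
    have : Finite X := Finite.of_equiv _ e.symm.toEquiv
    refine ⟨(toFinite (Subtype.val '' X)).toFinset, by simp, ?_⟩
    rw [← Set.ncard_eq_toFinset_card _ (toFinite _),
      ncard_image_of_injective _ Subtype.val_injective,
      ← Nat.card_coe_set_eq, Nat.card_congr e.toEquiv, natCard_Iio_natCast]
  have hsub : ∀ X : Set (Iio r), Subtype.val '' X ⊆ Iio r := fun X => by
    rintro _ ⟨z, -, rfl⟩; exact z.2
  obtain ⟨X, i, hX, he⟩ := h fun s =>
    if ∀ x ∈ s.1, ∀ y ∈ s.1, x ≠ y → blue x y then 1 else 0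
  fin_cases i
  · obtain ⟨S, hS, hSm⟩ := key he
    refine ⟨S, hS ▸ hsub X, ?_, hSm⟩
    rw [hS]
    rintro _ ⟨x, hx, rfl⟩ _ ⟨y, hy, rfl⟩ hxy hbl
    have hxy' : x ≠ y := fun h => hxy (congrArg _ h)
    have := hX ⟨{x, y}, Finset.card_pair hxy'⟩ (by
      rw [Finset.coe_pair]; exact pair_subset hx hy)
    have hcon := hb.symm _ _ hbl
    simp [hbl, hcon] at this
  · obtain ⟨S, hS, hSk⟩ := key he
    refine absurd hSk (hno S (hS ▸ hsub X) ?_)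
    rw [hS]
    rintro _ ⟨x, hx, rfl⟩ _ ⟨y, hy, rfl⟩ hxy
    have hxy' : x ≠ y := fun h => hxy (congrArg _ h)
    have := hX ⟨{x, y}, Finset.card_pair hxy'⟩ (by
      rw [Finset.coe_pair]; exact pair_subset hx hy)
    by_contra hbl
    simp [hbl, hxy'] at this

/-! ### Iterating the stepping up -/

theorem rankArrow_omega0_opow (ha : a.card ≤ ℵ₀) (hk : 0 < k) :
    RankArrow (ω ^ (a * k)) (ω ^ a) (k + 1) := by
  induction k, hk using Nat.le_induction with
  | base => simpa using rankArrow_two (ω ^ a)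
  | succ k hk ih =>
    have := ih.succ (countable_Iic (card_omega0_opow_le ha))
    rwa [← Ordinal.opow_add, ← mul_add_one, ← Nat.cast_succ] at this

/-- Each step multiplies the rank by `ω ^ (1 + a)`, which is `ω ^ a` for infinite `a`. -/
theorem pointRankArrow_of_omega0_le (ha : a.card ≤ ℵ₀) (haω : ω ≤ a) (hk : 0 < k) :
    PointRankArrow (ω ^ (a * k)) (ω ^ a) m (k + 1) := by
  induction k, hk using Nat.le_induction with
  | base => simpa using pointRankArrow_two (ω ^ a) m
  | succ k hk ih =>
    have := ih.succ (d := a * k + 1)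
      ((Ordinal.opow_lt_opow_iff_right Ordinal.one_lt_omega0).2 (by simp))
      (countable_Iic (card_omega0_opow_le ha))
    rwa [← Ordinal.opow_add, add_assoc, Ordinal.one_add_of_omega0_le haω, ← mul_add_one,
      ← Nat.cast_succ] at this

theorem pointRankArrow_natCast (hk : 0 < k) :
    PointRankArrow (ω ^ (((n + 1) * k - 1 : ℕ) : Ordinal.{u})) (ω ^ (n : Ordinal.{u})) m
      (k + 1) := by
  induction k, hk using Nat.le_induction with
  | base => simpa using pointRankArrow_two (ω ^ (n : Ordinal.{u})) m
  | succ k hk ih =>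
    have hpos : 0 < (n + 1) * k := by positivity
    have := ih.succ (d := ((n + 1) * k : ℕ))
      ((Ordinal.opow_lt_opow_iff_right Ordinal.one_lt_omega0).2 (by exact_mod_cast (by omega)))
      (countable_Iic (card_omega0_opow_le (card_natCast_le n)))
    rwa [← Ordinal.opow_add, ← Nat.cast_add,
      show (n + 1) * k + n = (n + 1) * (k + 1) - 1 by rw [mul_add_one]; omega] at this

theorem pointRankArrow_omega0_opow_mul_natCast (n m k : ℕ) :
    PointRankArrow (ω ^ (k : Ordinal.{u}) * n) n m (k + 2) := by
  induction k with
  | zero => simpa using pointRankArrow_two (n : Ordinal.{u}) m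
  | succ k ih =>
    refine ih.succ ?_ (countable_Iic (card_natCast_le n))
    rw [Nat.cast_succ, Ordinal.opow_add_one]
    exact mul_lt_mul_of_pos_left (Ordinal.natCast_lt_omega0 n)
      (Ordinal.opow_pos _ Ordinal.omega0_pos)

theorem exists_isRed_Iio_one {blue : Ordinal.{u} → Ordinal.{u} → Prop} :
    ∃ S : Finset Ordinal.{u}, (S : Set Ordinal.{u}) ⊆ Iio 1 ∧ IsRed blue S ∧ S.card = 1 :=
  ⟨{0}, by simp, by simp [IsRed], rfl⟩

theorem strongArrow_omega0_opow (ha : a.card ≤ ℵ₀) (hk : 0 < k) :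
    StrongArrow (ω ^ ω ^ (a * k)) (ω ^ ω ^ a) (k + 1) :=
  (rankArrow_omega0_opow ha hk).strongArrow
    (card_omega0_opow_le (card_mul_le ha (card_natCast_le k)))
    (card_omega0_opow_le ha) (Ordinal.opow_pos a Ordinal.omega0_pos)

theorem PointRankArrow.strongArrow_add_one (h : PointRankArrow b t 1 k) (hb : b.card ≤ ℵ₀)
    (ht : t.card ≤ ℵ₀) (ht0 : 0 < t) : StrongArrow (ω ^ b + 1) (ω ^ t + 1) k := by
  simpa using h.strongArrow hb ht ht0 one_pos (r := 1) (by simp)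
    fun _ _ _ => exists_isRed_Iio_one

end OrdinalRamsey

theorem mainTheorem2 :
    -- (1)
    (∀ α : Ordinal.{u}, α ≠ 0 → α.card ≤ ℵ₀ → ∀ k : ℕ, 0 < k →
      ∃ ρ : Ordinal.{u},
        OrdinalRamsey.IsTopRamsey (ω ^ ω ^ α) (k + 1) ρ ∧
        OrdinalRamsey.IsClosedRamsey (ω ^ ω ^ α) (k + 1) ρ ∧
        ρ ≤ ω ^ ω ^ (α * (k : Ordinal.{u}))) ∧
    -- (2)
    (∀ α : Ordinal.{u}, α ≠ 0 → α.card ≤ ℵ₀ → ∀ k : ℕ, 0 < k →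
      ∃ ρ : Ordinal.{u},
        OrdinalRamsey.IsTopRamsey (ω ^ ω ^ α + 1) (k + 1) ρ ∧
        OrdinalRamsey.IsClosedRamsey (ω ^ ω ^ α + 1) (k + 1) ρ ∧
        (ω ≤ α → ρ ≤ ω ^ ω ^ (α * (k : Ordinal.{u})) + 1) ∧
        (∀ n : ℕ, α = (n : Ordinal.{u}) →
          ρ ≤ ω ^ ω ^ (((n + 1) * k - 1 : ℕ) : Ordinal.{u}) + 1)) ∧
    -- (3)
    (∀ k m n : ℕ, 0 < k → 0 < m → 0 < n →
      ∃ r ρ : Ordinal.{u},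
        OrdinalRamsey.IsRamsey (m : Ordinal.{u}) (k + 2) r ∧
        OrdinalRamsey.IsTopRamsey
          (ω ^ (n : Ordinal.{u}) * (m : Ordinal.{u}) + 1) (k + 2) ρ ∧
        OrdinalRamsey.IsClosedRamsey
          (ω ^ (n : Ordinal.{u}) * (m : Ordinal.{u}) + 1) (k + 2) ρ ∧
        ρ ≤ ω ^ (ω ^ (k : Ordinal.{u}) * (n : Ordinal.{u})) * r + 1) ∧
    -- all topological and closed Ramsey numbers of countable ordinals are countable
    (∀ α : Ordinal.{u}, α.card ≤ ℵ₀ → ∀ k : ℕ, 0 < k →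
      (∃ ρ : Ordinal.{u}, OrdinalRamsey.IsTopRamsey α k ρ ∧ ρ.card ≤ ℵ₀) ∧
      (∃ ρ : Ordinal.{u}, OrdinalRamsey.IsClosedRamsey α k ρ ∧ ρ.card ≤ ℵ₀)) := by
  open OrdinalRamsey in
  refine ⟨fun α hα hc k hk => ?_, fun α hα hc k hk => ?_, fun k m n hk hm hn => ?_,
    fun α hc k hk => ?_⟩
  · refine (strongArrow_omega0_opow hc hk).exists_ramsey
      (orderReinforcing_omega0_opow ?_ (card_omega0_opow_le hc))
    exact Ordinal.isSuccLimit_opow_left Ordinal.isSuccLimit_omega0 hα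
  · have hθ := card_omega0_opow_le hc
    have hθ0 : 0 < ω ^ α := Ordinal.opow_pos α Ordinal.omega0_pos
    have hr : OrderReinforcing (ω ^ ω ^ α + 1) := by
      simpa using orderReinforcing_omega0_opow_mul_add_one hθ0 hθ one_pos
    rcases le_or_gt ω α with hω | hω
    · obtain ⟨ρ, h1, h2, h3⟩ := ((pointRankArrow_of_omega0_le hc hω hk).strongArrow_add_one
        (card_omega0_opow_le (card_mul_le hc (card_natCast_le k))) hθ hθ0).exists_ramsey hr
      refine ⟨ρ, h1, h2, fun _ => h3, ?_⟩
      rintro n rfl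
      exact absurd hω (Ordinal.natCast_lt_omega0 n).not_ge
    · obtain ⟨p, rfl⟩ := Ordinal.lt_omega0.1 hω
      obtain ⟨ρ, h1, h2, h3⟩ := ((pointRankArrow_natCast hk).strongArrow_add_one
        (card_omega0_opow_le (card_natCast_le _)) hθ hθ0).exists_ramsey hr
      refine ⟨ρ, h1, h2, fun h => absurd hω h.not_gt, fun n hn => ?_⟩
      obtain rfl : p = n := by exact_mod_cast hn
      exact h3
  · obtain ⟨r, hr, hrω⟩ : ∃ r, IsRamsey m (k + 2) r ∧ r ≤ ω :=
      exists_isLeast_le (arrow_omega0.{u} m (k + 2))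
    have hn0 : (0 : Ordinal.{u}) < n := by exact_mod_cast hn
    have hrc : r.card ≤ ℵ₀ := (Ordinal.card_le_card hrω).trans (by simp)
    obtain ⟨ρ, h⟩ := ((pointRankArrow_omega0_opow_mul_natCast n m k).strongArrow
      (card_mul_le (card_omega0_opow_le (card_natCast_le k)) (card_natCast_le n))
      (card_natCast_le n) hn0 hm hrc fun _ hb hno => Arrow.exists_isRed hr.1 hb hno).exists_ramsey
      (orderReinforcing_omega0_opow_mul_add_one hn0 (card_natCast_le n) hm)
    exact ⟨r, ρ, hr, h⟩
  · have h : StrongArrow (ω ^ ω ^ (α * k)) α k :=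
      (strongArrow_omega0_opow hc hk).mono
        ((Ordinal.right_le_opow _ Ordinal.one_lt_omega0).trans
          (Ordinal.right_le_opow _ Ordinal.one_lt_omega0)) (Nat.le_succ k)
    have hcard : (ω ^ ω ^ (α * k)).card ≤ ℵ₀ :=
      card_omega0_opow_le (card_omega0_opow_le (card_mul_le hc (card_natCast_le k)))
    obtain ⟨ρ, hρ, hle⟩ : ∃ ρ, IsClosedRamsey α k ρ ∧ ρ ≤ _ :=
      exists_isLeast_le h.closedArrow
    obtain ⟨σ, hσ, hle'⟩ : ∃ σ, IsTopRamsey α k σ ∧ σ ≤ _ :=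
      exists_isLeast_le (closedArrow_topArrow h.closedArrow)
    exact ⟨⟨σ, hσ, (Ordinal.card_le_card hle').trans hcard⟩,
      ⟨ρ, hρ, (Ordinal.card_le_card hle).trans hcard⟩⟩
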